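/- Let $K_n$ be the complete graph on $n$ vertices. For $e\ge 1$, an $e$-star is a complete bipartite graph $K_{1,e}$, and an $e$-star system of order $n$ is a pair $(V,\mathcal B)$, where $V$ is the vertex set of $K_n$ and $\mathcal B$ is a set of subgraphs of $K_n$ (blocks), each isomorphic to $K_{1,e}$, such that every edge of $K_n$ lies in exactly one block. A $k$-colouring of $(V,\mathcal B)$ is a map from $V$ to a set of $k$ colours such that no block has all of its vertices of the same colour. The system is $k$-chromatic if it has a $k$-colouring but no $(k-1)$-colouring, and uniquely $k$-chromatic if, in addition, every $k$-colouring can be obtained from one fixed $k$-colouring by a permutation of the colours. **Corollary.** For every integer $e\ge 3$ there is an integer $n_0\ge 0$ with $n_0\equiv 0 \pmod{2e}$ such that for every integer $n\ge n_0$ with $n\equiv 0$ or $1\pmod{2e}$ there exists a uniquely $2$-chromatic $e$-star system of order $n$. -/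

import Mathlib

/-- `𝓑` is a `G`-decomposition of `H`: a set of subgraphs of `H`, each isomorphic to `G`, such that
every edge of `H` lies in exactly one of them. -/
structure IsGraphDecomposition {V W : Type*} (H : SimpleGraph V) (G : SimpleGraph W)
    (𝓑 : Set H.Subgraph) : Prop where
  isomorphic : ∀ B ∈ 𝓑, Nonempty (B.coe ≃g G)
  edge_partition : ∀ x ∈ H.edgeSet, ∃! B : H.Subgraph, B ∈ 𝓑 ∧ x ∈ B.edgeSet

/-- The `e`-star `K_{1,e}`. -/
abbrev starGraphOfSize (e : ℕ) : SimpleGraph (Fin 1 ⊕ Fin e) :=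
  completeBipartiteGraph (Fin 1) (Fin e)

/-- `(V, 𝓑)` is an `e`-star system: a decomposition of the complete graph on `V` into `e`-stars.
Its order is the number of elements of `V`. -/
abbrev IsStarSystem {V : Type*} (e : ℕ) (𝓑 : Set (⊤ : SimpleGraph V).Subgraph) : Prop :=
  IsGraphDecomposition (⊤ : SimpleGraph V) (starGraphOfSize e) 𝓑

/-- `φ` is a (weak) `k`-colouring of `(V, 𝓑)`: no block is monochromatic, that is, no block has all
of its vertices in a single colour class. -/
def IsBlockColouring {V : Type*} {H : SimpleGraph V} (𝓑 : Set H.Subgraph) {k : ℕ}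
    (φ : V → Fin k) : Prop :=
  ∀ B ∈ 𝓑, ¬ ∃ i : Fin k, ∀ v ∈ B.verts, φ v = i

/-- `(V, 𝓑)` is `k`-colourable. -/
def IsBlockColourable {V : Type*} {H : SimpleGraph V} (𝓑 : Set H.Subgraph) (k : ℕ) : Prop :=
  ∃ φ : V → Fin k, IsBlockColouring 𝓑 φ

/-- `(V, 𝓑)` is `k`-chromatic: it is `k`-colourable but not `(k-1)`-colourable. -/
def IsBlockChromatic {V : Type*} {H : SimpleGraph V} (𝓑 : Set H.Subgraph) (k : ℕ) : Prop :=
  IsBlockColourable 𝓑 k ∧ ¬ IsBlockColourable 𝓑 (k - 1)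

/-- `(V, 𝓑)` is uniquely `k`-colourable: every `k`-colouring is obtained from some fixed
`k`-colouring by a permutation of the colours. -/
def IsUniquelyBlockColourable {V : Type*} {H : SimpleGraph V} (𝓑 : Set H.Subgraph) (k : ℕ) :
    Prop :=
  ∃ φ : V → Fin k, IsBlockColouring 𝓑 φ ∧
    ∀ ψ : V → Fin k, IsBlockColouring 𝓑 ψ → ∃ σ : Equiv.Perm (Fin k), ψ = σ ∘ φ

/-- `(V, 𝓑)` is uniquely `k`-chromatic: it is `k`-chromatic and uniquely `k`-colourable. -/
def IsUniquelyBlockChromatic {V : Type*} {H : SimpleGraph V} (𝓑 : Set H.Subgraph) (k : ℕ) :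
    Prop :=
  IsBlockChromatic 𝓑 k ∧ IsUniquelyBlockColourable 𝓑 k

open Finset

/-! Points are coloured by `stripe e`, and designs grow by joining: new points W carry their own
design, and each w in W is the centre of stars whose leaf sets partition the old points
(`IsStarDesign.join`). `stripe e` stays a colouring if every part at w contains a point of the
colour opposite to w. Apart from this the partition is free, and this freedom is used to destroy all
other colourings.

Fix a base V₀ whose colourings all use each colour at least e times (`exists_isStarDesign_card_le`).
Suppose a colouring has class D on V₀ and splits a stripe class c. Then D and V₀ \ D both contain
points of stripe c, so a new point w of the other stripe may have one part inside D and one inside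
V₀ \ D (`exists_separating_partition`). Whatever colour w receives, one of these two stars is
monochromatic, so D no longer occurs (`IsForcedExtension.exists_exclude`). V₀ has finitely many
subsets, so finitely many groups leave only the stripe colouring on V₀, up to swapping colours.

Each new point also has a star with all leaves in V₀ and of the opposite stripe. This fixes its
colour, so uniqueness on V₀ spreads to all points and survives further joins, which yield all large
orders. -/

/-! ### Star designs, equipartitions and joins. -/

/-- A set of `e`-stars, given as pairs (centre, leaves), that covers every pair of points of `X`
exactly once. -/
structure IsStarDesign (e : ℕ) (X : Finset ℕ) (𝓢 : Set (ℕ × Finset ℕ)) : Prop where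
  centre_mem : ∀ s ∈ 𝓢, s.1 ∈ X
  leaves_subset : ∀ s ∈ 𝓢, s.2 ⊆ X
  centre_notMem : ∀ s ∈ 𝓢, s.1 ∉ s.2
  card_leaves : ∀ s ∈ 𝓢, #s.2 = e
  existsUnique : ∀ x ∈ X, ∀ y ∈ X, x ≠ y →
    ∃! s, s ∈ 𝓢 ∧ (s.1 = x ∧ y ∈ s.2 ∨ s.1 = y ∧ x ∈ s.2)

/-- No star of `𝓢` is monochromatic under `ψ`. -/
def IsStarColouring (𝓢 : Set (ℕ × Finset ℕ)) (ψ : ℕ → Fin 2) : Prop :=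
  ∀ s ∈ 𝓢, ∃ v ∈ s.2, ψ v ≠ ψ s.1

theorem IsStarColouring.mono {𝓢 𝓢' : Set (ℕ × Finset ℕ)} {ψ : ℕ → Fin 2}
    (h : IsStarColouring 𝓢' ψ) (hs : 𝓢 ⊆ 𝓢') : IsStarColouring 𝓢 ψ :=
  fun s hs' => h s (hs hs')

/-- `𝒬` is a partition of `X` into sets of size `e`. -/
structure IsEquiPartition (e : ℕ) (X : Finset ℕ) (𝒬 : Set (Finset ℕ)) : Prop where
  subset : ∀ S ∈ 𝒬, S ⊆ X
  card : ∀ S ∈ 𝒬, #S = e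
  existsUnique : ∀ x ∈ X, ∃! S, S ∈ 𝒬 ∧ x ∈ S

theorem IsEquiPartition.insert {e : ℕ} {X S : Finset ℕ} {𝒬 : Set (Finset ℕ)}
    (h : IsEquiPartition e (X \ S) 𝒬) (hS : S ⊆ X) (hc : #S = e) :
    IsEquiPartition e X (insert S 𝒬) := by
  refine ⟨?_, ?_, ?_⟩
  · rintro T (rfl | hT)
    · exact hS
    · exact (h.subset T hT).trans sdiff_subset
  · rintro T (rfl | hT)
    · exact hc
    · exact h.card T hT
  · intro x hx
    by_cases hxS : x ∈ S
    · refine ⟨S, ⟨Or.inl rfl, hxS⟩, ?_⟩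
      rintro T ⟨rfl | hT, hxT⟩
      · rfl
      · exact absurd hxS (mem_sdiff.1 (h.subset T hT hxT)).2
    · obtain ⟨T, ⟨hT, hxT⟩, hu⟩ := h.existsUnique x (mem_sdiff.2 ⟨hx, hxS⟩)
      refine ⟨T, ⟨Or.inr hT, hxT⟩, ?_⟩
      rintro T' ⟨rfl | hT', hxT'⟩
      · exact absurd hxT' hxS
      · exact hu T' ⟨hT', hxT'⟩

/-- A set of size `e * r` can be split into `r` sets of size `e`, each of which contains one of
`r` prescribed elements. -/
theorem exists_isEquiPartition_meeting {e : ℕ} (he : 1 ≤ e) (r : ℕ) :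
    ∀ X Y : Finset ℕ, Y ⊆ X → #X = e * r → #Y = r →
      ∃ 𝒬, IsEquiPartition e X 𝒬 ∧ ∀ S ∈ 𝒬, ∃ y ∈ S, y ∈ Y := by
  induction r with
  | zero =>
    intro X Y _ hX _
    have hX : X = ∅ := by simpa using hX
    subst hX
    exact ⟨∅, ⟨by simp, by simp, by simp⟩, by simp⟩
  | succ r ih =>
    intro X Y hYX hX hY
    obtain ⟨y, hy⟩ : Y.Nonempty := card_pos.1 (by omega)
    have h1 : #(X \ Y) = e * r + e - (r + 1) := by
      rw [card_sdiff_of_subset hYX, hX, hY]; ring_nf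
    have h2 : r ≤ e * r := Nat.le_mul_of_pos_left r he
    -- The part uses up only one element of `Y`, so `r` of them remain for the other `r` parts.
    obtain ⟨Z, hZ, hZc⟩ := exists_subset_card_eq (s := X \ Y) (n := e - 1) (by omega)
    have hyZ : y ∉ Z := fun h => (mem_sdiff.1 (hZ h)).2 hy
    have hSX : insert y Z ⊆ X :=
      insert_subset (hYX hy) (hZ.trans sdiff_subset)
    have hSc : #(insert y Z) = e := by rw [card_insert_of_notMem hyZ, hZc]; omega
    obtain ⟨𝒬, h𝒬, hm⟩ := ih (X \ insert y Z) (Y.erase y)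
      (by
        intro z hz
        obtain ⟨hzy, hzY⟩ := mem_erase.1 hz
        refine mem_sdiff.2 ⟨hYX hzY, fun h => ?_⟩
        rcases mem_insert.1 h with h | h
        · exact hzy h
        · exact (mem_sdiff.1 (hZ h)).2 hzY)
      (by rw [card_sdiff_of_subset hSX, hSc, hX]; rw [Nat.mul_succ]; omega)
      (by rw [card_erase_of_mem hy, hY]; rfl)
    refine ⟨insert (insert y Z) 𝒬, h𝒬.insert hSX hSc, ?_⟩
    rintro S (rfl | hS)
    · exact ⟨y, mem_insert_self _ _, hy⟩
    · obtain ⟨z, hz, hzY⟩ := hm S hS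
      exact ⟨z, hz, mem_of_mem_erase hzY⟩

/-- The stars centred at the points of `W` whose leaf sets are the parts of `𝒬`. -/
def joinStars (W : Finset ℕ) (𝒬 : ℕ → Set (Finset ℕ)) : Set (ℕ × Finset ℕ) :=
  {s | s.1 ∈ W ∧ s.2 ∈ 𝒬 s.1}

theorem IsStarDesign.join {e : ℕ} {X W : Finset ℕ} {𝓢 𝓣 : Set (ℕ × Finset ℕ)}
    {𝒬 : ℕ → Set (Finset ℕ)} (h𝓢 : IsStarDesign e X 𝓢) (h𝓣 : IsStarDesign e W 𝓣)
    (hd : Disjoint X W) (h𝒬 : ∀ w ∈ W, IsEquiPartition e X (𝒬 w)) :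
    IsStarDesign e (X ∪ W) (𝓢 ∪ 𝓣 ∪ joinStars W 𝒬) := by
  have hXW : ∀ x ∈ X, x ∉ W := fun x hx hw => disjoint_left.1 hd hx hw
  have cross : ∀ x ∈ X, ∀ w ∈ W, ∃! s, s ∈ 𝓢 ∪ 𝓣 ∪ joinStars W 𝒬 ∧
      (s.1 = w ∧ x ∈ s.2 ∨ s.1 = x ∧ w ∈ s.2) := by
    intro x hx w hw
    obtain ⟨S, ⟨hS, hxS⟩, hu⟩ := (h𝒬 w hw).existsUnique x hx
    refine ⟨(w, S), ⟨Or.inr ⟨hw, hS⟩, Or.inl ⟨rfl, hxS⟩⟩, ?_⟩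
    rintro ⟨c, L⟩ ⟨(hs | hs) | ⟨hc, hs⟩, ⟨h1, h2⟩ | ⟨h1, h2⟩⟩ <;> dsimp only at *
    · exact absurd hw (hXW w (h1 ▸ h𝓢.centre_mem _ hs))
    · exact absurd hw (hXW w (h𝓢.leaves_subset _ hs h2))
    · exact absurd (h𝓣.leaves_subset _ hs h2) (hXW x hx)
    · exact absurd (h1 ▸ h𝓣.centre_mem _ hs) (hXW x hx)
    · subst h1
      rw [hu L ⟨hs, h2⟩]
    · exact absurd (h1 ▸ hc) (hXW x hx)
  refine ⟨?_, ?_, ?_, ?_, ?_⟩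
  · rintro s ((hs | hs) | hs)
    · exact mem_union_left _ (h𝓢.centre_mem s hs)
    · exact mem_union_right _ (h𝓣.centre_mem s hs)
    · exact mem_union_right _ hs.1
  · rintro s ((hs | hs) | hs)
    · exact (h𝓢.leaves_subset s hs).trans subset_union_left
    · exact (h𝓣.leaves_subset s hs).trans subset_union_right
    · exact ((h𝒬 _ hs.1).subset _ hs.2).trans subset_union_left
  · rintro s ((hs | hs) | hs)
    · exact h𝓢.centre_notMem s hs
    · exact h𝓣.centre_notMem s hs
    · exact fun h => hXW _ ((h𝒬 _ hs.1).subset _ hs.2 h) hs.1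
  · rintro s ((hs | hs) | hs)
    · exact h𝓢.card_leaves s hs
    · exact h𝓣.card_leaves s hs
    · exact (h𝒬 _ hs.1).card _ hs.2
  · intro x hx y hy hxy
    rcases mem_union.1 hx with hx | hx <;> rcases mem_union.1 hy with hy | hy
    · obtain ⟨s, ⟨hs, h⟩, hu⟩ := h𝓢.existsUnique x hx y hy hxy
      refine ⟨s, ⟨Or.inl (Or.inl hs), h⟩, ?_⟩
      rintro t ⟨(ht | ht) | ht, h'⟩
      · exact hu t ⟨ht, h'⟩
      · have := h𝓣.centre_mem t ht
        rcases h' with ⟨h1, -⟩ | ⟨h1, -⟩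
        · exact absurd (h1 ▸ this) (hXW x hx)
        · exact absurd (h1 ▸ this) (hXW y hy)
      · have := ht.1
        rcases h' with ⟨h1, -⟩ | ⟨h1, -⟩
        · exact absurd (h1 ▸ this) (hXW x hx)
        · exact absurd (h1 ▸ this) (hXW y hy)
    · simpa only [or_comm] using cross x hx y hy
    · exact cross y hy x hx
    · obtain ⟨s, ⟨hs, h⟩, hu⟩ := h𝓣.existsUnique x hx y hy hxy
      refine ⟨s, ⟨Or.inl (Or.inr hs), h⟩, ?_⟩
      rintro t ⟨(ht | ht) | ht, h'⟩
      · have := h𝓢.centre_mem t ht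
        rcases h' with ⟨h1, -⟩ | ⟨h1, -⟩
        · exact absurd hx (hXW x (h1 ▸ this))
        · exact absurd hy (hXW y (h1 ▸ this))
      · exact hu t ⟨ht, h'⟩
      · have := (h𝒬 _ ht.1).subset _ ht.2
        rcases h' with ⟨-, h1⟩ | ⟨-, h1⟩
        · exact absurd hy (hXW y (this h1))
        · exact absurd hx (hXW x (this h1))

theorem IsStarDesign.exists_star {e : ℕ} {X : Finset ℕ} {𝓢 : Set (ℕ × Finset ℕ)}
    (h : IsStarDesign e X 𝓢) {x y : ℕ} (hx : x ∈ X) (hy : y ∈ X) (hxy : x ≠ y) :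
    ∃ s, s ∈ 𝓢 :=
  let ⟨s, hs, _⟩ := h.existsUnique x hx y hy hxy
  ⟨s, hs.1⟩

/-- A single point carries the empty star design. -/
theorem isStarDesign_singleton (e x : ℕ) : IsStarDesign e {x} ∅ := by
  refine ⟨by simp, by simp, by simp, by simp, ?_⟩
  intro a ha b hb hab
  simp only [mem_singleton] at ha hb
  omega

/-! ### The stripe colouring and the cyclic design on one group. -/

/-- The colouring of the natural numbers that alternates between blocks of `e` zeros and
`e` ones. -/
def stripe (e x : ℕ) : Fin 2 := if x % (2 * e) < e then 0 else 1

theorem stripe_eq_zero {e m x : ℕ} (h1 : 2 * e * m ≤ x) (h2 : x < 2 * e * m + e) :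
    stripe e x = 0 := by
  obtain ⟨r, rfl⟩ := Nat.exists_eq_add_of_le h1
  rw [stripe, Nat.mul_add_mod, Nat.mod_eq_of_lt (by omega), if_pos (by omega)]

theorem stripe_eq_one {e m x : ℕ} (h1 : 2 * e * m + e ≤ x) (h2 : x < 2 * e * m + 2 * e) :
    stripe e x = 1 := by
  obtain ⟨r, rfl⟩ := Nat.exists_eq_add_of_le (show 2 * e * m ≤ x by omega)
  rw [stripe, Nat.mul_add_mod, Nat.mod_eq_of_lt (by omega), if_neg (by omega)]

theorem range_mul_succ (e m : ℕ) :
    range (2 * e * (m + 1)) = range (2 * e * m) ∪ Ico (2 * e * m) (2 * e * m + 2 * e) := by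
  ext x
  simp only [Nat.mul_succ, mem_range, mem_union, mem_Ico]
  omega

theorem disjoint_range_Ico (a b : ℕ) : Disjoint (range a) (Ico a b) := by
  rw [disjoint_left]
  intro x hx hx'
  simp only [mem_range, mem_Ico] at hx hx'
  omega

theorem card_filter_stripe (e m : ℕ) (c : Fin 2) :
    #{x ∈ range (2 * e * m) | stripe e x = c} = e * m := by
  induction m with
  | zero => simp
  | succ m ih =>
    rw [range_mul_succ, filter_union, card_union_of_disjoint
      (disjoint_filter_filter (disjoint_range_Ico _ _)), ih, Nat.mul_succ]
    congr 1
    have h : {x ∈ Ico (2 * e * m) (2 * e * m + 2 * e) | stripe e x = c} =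
        if c = 0 then Ico (2 * e * m) (2 * e * m + e)
        else Ico (2 * e * m + e) (2 * e * m + 2 * e) := by
      ext x
      have h0 := @stripe_eq_zero e m x
      have h1 := @stripe_eq_one e m x
      rcases Fin.exists_fin_two.1 ⟨c, rfl⟩ with rfl | rfl <;> simp only [mem_filter, mem_Ico] <;>
        by_cases hx : x < 2 * e * m + e <;> by_cases hx' : 2 * e * m ≤ x <;>
        by_cases hx'' : x < 2 * e * m + 2 * e <;> simp_all <;> omega
    rw [h]
    split_ifs
    · simp
    · simp; omega

/-- The leaves of the star at the point `n + i` of the cyclic design on `n, …, n + 2e - 1`, where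
the fixed point is `n`. -/
def cyclicLeaves (e n i : ℕ) : Finset ℕ :=
  {x ∈ Ico n (n + 2 * e) | x = n ∨ (n + i < x ∧ x < n + i + e) ∨ (x + e ≤ n + i)}

theorem mem_cyclicLeaves {e n i x : ℕ} : x ∈ cyclicLeaves e n i ↔ (n ≤ x ∧ x < n + 2 * e) ∧
    (x = n ∨ (n + i < x ∧ x < n + i + e) ∨ (x + e ≤ n + i)) := by
  simp [cyclicLeaves]

theorem card_cyclicLeaves {e n i : ℕ} (h1 : 1 ≤ i) (h2 : i < 2 * e) :
    #(cyclicLeaves e n i) = e := by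
  by_cases hi : i ≤ e
  · have : cyclicLeaves e n i = insert n (Ioo (n + i) (n + i + e)) := by
      ext x
      simp only [mem_cyclicLeaves, mem_insert, mem_Ioo]
      omega
    rw [this, card_insert_of_notMem (by simp), Nat.card_Ioo]
    omega
  · have : cyclicLeaves e n i = Icc n (n + i - e) ∪ Ioo (n + i) (n + 2 * e) := by
      ext x
      simp only [mem_cyclicLeaves, mem_union, mem_Ioo, mem_Icc]
      omega
    rw [this, card_union_of_disjoint, Nat.card_Ioo, Nat.card_Icc]
    · omega
    · rw [disjoint_left]
      intro x hx hx'
      simp only [mem_Icc, mem_Ioo] at hx hx'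
      omega

/-- The points other than `n` form a cycle of odd length `2e - 1`. The star at each of them takes
`n` and its `e - 1` successors; of two points on the cycle, exactly one is among the `e - 1`
successors of the other. -/
theorem isStarDesign_cyclic (e n : ℕ) :
    IsStarDesign e (Ico n (n + 2 * e))
      {s | ∃ i, 1 ≤ i ∧ i < 2 * e ∧ s = (n + i, cyclicLeaves e n i)} := by
  refine ⟨?_, ?_, ?_, ?_, ?_⟩
  · rintro _ ⟨i, h1, h2, rfl⟩
    simp only [mem_Ico]
    omega
  · rintro _ ⟨i, h1, h2, rfl⟩
    exact filter_subset _ _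
  · rintro _ ⟨i, h1, h2, rfl⟩
    simp only [mem_cyclicLeaves]
    omega
  · rintro _ ⟨i, h1, h2, rfl⟩
    exact card_cyclicLeaves h1 h2
  · have key : ∀ x y, n ≤ x → x < y → y < n + 2 * e →
        ∃! s, s ∈ {s | ∃ i, 1 ≤ i ∧ i < 2 * e ∧ s = (n + i, cyclicLeaves e n i)} ∧
          (s.1 = x ∧ y ∈ s.2 ∨ s.1 = y ∧ x ∈ s.2) := by
      intro x y hx hxy hy
      by_cases h : n < x ∧ y < x + e
      · refine ⟨(n + (x - n), cyclicLeaves e n (x - n)),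
          ⟨⟨x - n, by omega, by omega, rfl⟩, Or.inl ⟨by simp; omega, ?_⟩⟩, ?_⟩
        · simp only [mem_cyclicLeaves]; omega
        · rintro _ ⟨⟨i, h1, h2, rfl⟩, ⟨h3, h4⟩ | ⟨h3, h4⟩⟩ <;> simp only [mem_cyclicLeaves] at h3 h4
          · rw [show x - n = i by omega]
          · omega
      · refine ⟨(n + (y - n), cyclicLeaves e n (y - n)),
          ⟨⟨y - n, by omega, by omega, rfl⟩, Or.inr ⟨by simp; omega, ?_⟩⟩, ?_⟩
        · simp only [mem_cyclicLeaves]; omega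
        · rintro _ ⟨⟨i, h1, h2, rfl⟩, ⟨h3, h4⟩ | ⟨h3, h4⟩⟩ <;> simp only [mem_cyclicLeaves] at h3 h4
          · omega
          · rw [show y - n = i by omega]
    intro x hx y hy hxy
    simp only [mem_Ico] at hx hy
    rcases lt_or_gt_of_ne hxy with h | h
    · exact key x y hx.1 h hy.2
    · simpa only [or_comm] using key y x hy.1 h hx.2

theorem isStarColouring_cyclic (e : ℕ) (m : ℕ) :
    IsStarColouring {s | ∃ i, 1 ≤ i ∧ i < 2 * e ∧
      s = (2 * e * m + i, cyclicLeaves e (2 * e * m) i)} (stripe e) := by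
  rintro _ ⟨i, h1, h2, rfl⟩
  by_cases hi : i < e
  · refine ⟨2 * e * m + e, by simp only [mem_cyclicLeaves]; omega, ?_⟩
    rw [stripe_eq_one (m := m) (by omega) (by omega),
      stripe_eq_zero (m := m) (by simp) (by simpa)]
    decide
  · refine ⟨2 * e * m, by simp only [mem_cyclicLeaves]; omega, ?_⟩
    rw [stripe_eq_zero (m := m) (by omega) (by omega),
      stripe_eq_one (m := m) (by simp; omega) (by simpa)]
    decide

/-- On each group of `2e` consecutive points there is a star design coloured by `stripe e`. -/
theorem exists_group (e : ℕ) (m : ℕ) :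
    ∃ 𝓣, IsStarDesign e (Ico (2 * e * m) (2 * e * m + 2 * e)) 𝓣 ∧
      IsStarColouring 𝓣 (stripe e) :=
  ⟨_, isStarDesign_cyclic e _, isStarColouring_cyclic e m⟩

/-! ### Joins coloured by stripes, and a base that needs both colours often. -/

theorem isStarColouring_join {W : Finset ℕ} {𝓢 𝓣 : Set (ℕ × Finset ℕ)}
    {𝒬 : ℕ → Set (Finset ℕ)} {φ : ℕ → Fin 2} (h𝓢 : IsStarColouring 𝓢 φ)
    (h𝓣 : IsStarColouring 𝓣 φ) (h𝒬 : ∀ w ∈ W, ∀ S ∈ 𝒬 w, ∃ v ∈ S, φ v ≠ φ w) :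
    IsStarColouring (𝓢 ∪ 𝓣 ∪ joinStars W 𝒬) φ := by
  rintro s ((hs | hs) | hs)
  · exact h𝓢 s hs
  · exact h𝓣 s hs
  · exact h𝒬 _ hs.1 _ hs.2

/-- A coloured star design on `2em` points all of whose colourings use each colour at least `m`
times. -/
theorem exists_isStarDesign_card_le {e : ℕ} (he : 3 ≤ e) (m : ℕ) :
    ∃ 𝓢, IsStarDesign e (range (2 * e * m)) 𝓢 ∧ IsStarColouring 𝓢 (stripe e) ∧
      ∀ ψ, IsStarColouring 𝓢 ψ → ∀ c, m ≤ #{x ∈ range (2 * e * m) | ψ x = c} := by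
  induction m with
  | zero => exact ⟨∅, ⟨by simp, by simp, by simp, by simp, by simp⟩, by simp [IsStarColouring],
      by simp⟩
  | succ m ih =>
    obtain ⟨𝓢, h𝓢, hφ, hm⟩ := ih
    obtain ⟨𝓣, h𝓣, hφ'⟩ := exists_group e m
    have hpart : ∀ w : ℕ, ∃ 𝒬, IsEquiPartition e (range (2 * e * m)) 𝒬 ∧
        ∀ S ∈ 𝒬, ∃ v ∈ S, stripe e v ≠ stripe e w := by
      intro w
      obtain ⟨c, hc⟩ := exists_ne (stripe e w)
      obtain ⟨Y, hY, hYc⟩ := exists_subset_card_eq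
        (s := {x ∈ range (2 * e * m) | stripe e x = c}) (n := 2 * m)
        (by rw [card_filter_stripe]; exact Nat.mul_le_mul_right m (by omega))
      obtain ⟨𝒬, h𝒬, h⟩ := exists_isEquiPartition_meeting (e := e) (by omega) (2 * m)
        (range (2 * e * m)) Y (hY.trans (filter_subset _ _)) (by rw [card_range]; ring) hYc
      refine ⟨𝒬, h𝒬, fun S hS => ?_⟩
      obtain ⟨y, hyS, hyY⟩ := h S hS
      exact ⟨y, hyS, by rw [(mem_filter.1 (hY hyY)).2]; exact hc⟩
    choose 𝒬 h𝒬 h𝒬φ using hpart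
    refine ⟨_, range_mul_succ e m ▸ h𝓢.join h𝓣 (disjoint_range_Ico _ _) fun w _ => h𝒬 w,
      isStarColouring_join hφ hφ' fun w _ => h𝒬φ w, ?_⟩
    intro ψ hψ c
    rw [range_mul_succ, filter_union, card_union_of_disjoint
      (disjoint_filter_filter (disjoint_range_Ico _ _))]
    refine Nat.add_le_add
      (hm ψ (hψ.mono (Set.subset_union_left.trans Set.subset_union_left)) c) (card_pos.2 ?_)
    -- The new group contains a star, which is not monochromatic, so both colours occur in the
    -- group.
    obtain ⟨s, hs⟩ := h𝓣.exists_star (x := 2 * e * m) (y := 2 * e * m + 1)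
      (by simp; omega) (by simp; omega) (by omega)
    obtain ⟨v, hv, hne⟩ := hψ s (Or.inl (Or.inr hs))
    rcases (by omega : ψ v = c ∨ ψ s.1 = c) with h | h
    · exact ⟨v, mem_filter.2 ⟨h𝓣.leaves_subset s hs hv, h⟩⟩
    · exact ⟨s.1, mem_filter.2 ⟨h𝓣.centre_mem s hs, h⟩⟩

/-! ### Separating partitions and forced extensions. -/

theorem exists_subset_card_eq_of_mem {D : Finset ℕ} {e x : ℕ} (hx : x ∈ D) (he : 1 ≤ e)
    (h : e ≤ #D) : ∃ S ⊆ D, #S = e ∧ x ∈ S := by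
  obtain ⟨S, h1, h2, h3⟩ := exists_subsuperset_card_eq (s := {x}) (t := D) (n := e)
    (singleton_subset_iff.2 hx) (by simpa using he) h
  exact ⟨S, h2, h3, singleton_subset_iff.1 h1⟩

/-- If both `D` and `V₀ \ D` are large and contain the colour `c`, the point set has a partition
all of whose parts contain the colour `c`, with a part in `D`, a part in `V₀ \ D` and a part in
the colour class `c` of `V₀`. -/
theorem exists_separating_partition {e m m₀ : ℕ} (he : 3 ≤ e) (hm₀ : 6 ≤ m₀) (hm : m₀ ≤ m)
    {D : Finset ℕ} {c : Fin 2} (hD : D ⊆ range (2 * e * m₀)) (hDe : e ≤ #D)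
    (hDe' : e ≤ #(range (2 * e * m₀) \ D)) (h1 : ∃ x ∈ D, stripe e x = c)
    (h2 : ∃ x ∈ range (2 * e * m₀) \ D, stripe e x = c) :
    ∃ 𝒬, IsEquiPartition e (range (2 * e * m)) 𝒬 ∧ (∀ S ∈ 𝒬, ∃ v ∈ S, stripe e v = c) ∧
      (∃ S ∈ 𝒬, S ⊆ D) ∧ (∃ S ∈ 𝒬, S ⊆ range (2 * e * m₀) \ D) ∧
      (∃ S ∈ 𝒬, S ⊆ {x ∈ range (2 * e * m₀) | stripe e x = c}) := by
  obtain ⟨x, hxD, hxc⟩ := h1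
  obtain ⟨y, hyD, hyc⟩ := h2
  obtain ⟨S, hSD, hSe, hxS⟩ := exists_subset_card_eq_of_mem hxD (by omega) hDe
  obtain ⟨T, hTD, hTe, hyT⟩ := exists_subset_card_eq_of_mem hyD (by omega) hDe'
  have hsub : range (2 * e * m₀) ⊆ range (2 * e * m) :=
    range_subset_range.2 (Nat.mul_le_mul_left _ hm)
  have hST : T ⊆ range (2 * e * m) \ S := fun z hz =>
    mem_sdiff.2 ⟨hsub (mem_sdiff.1 (hTD hz)).1, fun h => (mem_sdiff.1 (hTD hz)).2 (hSD h)⟩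
  obtain ⟨U, hU, hUe⟩ := exists_subset_card_eq
    (s := {x ∈ range (2 * e * m₀) | stripe e x = c} \ (S ∪ T)) (n := e) (by
      have h3 := le_card_sdiff (S ∪ T) {x ∈ range (2 * e * m₀) | stripe e x = c}
      have h4 := card_union_le S T
      rw [card_filter_stripe] at h3
      have : e * 6 ≤ e * m₀ := Nat.mul_le_mul_left _ hm₀
      omega)
  have hUST : U ⊆ (range (2 * e * m) \ S) \ T := fun z hz => by
    have := hU hz
    simp only [mem_sdiff, mem_union, mem_filter] at this ⊢
    exact ⟨⟨hsub this.1.1, fun h => this.2 (Or.inl h)⟩, fun h => this.2 (Or.inr h)⟩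
  have hUc : U ⊆ {x ∈ range (2 * e * m₀) | stripe e x = c} := hU.trans sdiff_subset
  obtain ⟨Y, hY, hYc⟩ := exists_subset_card_eq
    (s := {x ∈ range (2 * e * m) | stripe e x = c} \ (S ∪ T ∪ U)) (n := 2 * m - 3) (by
      have h3 := le_card_sdiff (S ∪ T ∪ U) {x ∈ range (2 * e * m) | stripe e x = c}
      have h4 := card_union_le S T
      have h5 := card_union_le (S ∪ T) U
      rw [card_filter_stripe] at h3
      -- Class `c` has `e * m` points, of which `S`, `T`, `U` use at most `3 * e`; the other `2 * m
      -- - 3` parts need one each. For `e = 3` this is tight at `m = 6`.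
      have h6 : 2 * m + 3 * e ≤ e * m + 3 := by
        obtain ⟨a, rfl⟩ := Nat.exists_eq_add_of_le he
        obtain ⟨b, rfl⟩ := Nat.exists_eq_add_of_le (hm₀.trans hm)
        nlinarith [Nat.zero_le (a * b)]
      omega)
  obtain ⟨𝒬, h𝒬, h𝒬Y⟩ := exists_isEquiPartition_meeting (e := e) (by omega) (2 * m - 3)
    (((range (2 * e * m) \ S) \ T) \ U) Y
    (fun z hz => by
      have := hY hz
      simp only [mem_sdiff, mem_union, mem_filter] at this ⊢
      tauto)
    (by
      rw [card_sdiff_of_subset hUST, card_sdiff_of_subset hST,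
        card_sdiff_of_subset ((hSD.trans hD).trans hsub), hUe, hTe, hSe, card_range, Nat.mul_sub]
      have : 2 * e * m = e * (2 * m) := by ring
      omega) hYc
  refine ⟨_, ((h𝒬.insert hUST hUe).insert hST hTe).insert ((hSD.trans hD).trans hsub) hSe, ?_,
    ⟨S, by simp, hSD⟩, ⟨T, by simp, hTD⟩, ⟨U, by simp, hUc⟩⟩
  rintro R (rfl | rfl | rfl | hR)
  · exact ⟨x, hxS, hxc⟩
  · exact ⟨y, hyT, hyc⟩
  · obtain ⟨z, hz⟩ : R.Nonempty := card_pos.1 (by omega)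
    exact ⟨z, hz, (mem_filter.1 (hUc hz)).2⟩
  · obtain ⟨z, hz, hzY⟩ := h𝒬Y R hR
    exact ⟨z, hz, (mem_filter.1 (mem_sdiff.1 (hY hzY)).1).2⟩

/-- Every point of `X` outside `V₀` is the centre of a star with leaves in `V₀`, all of them of the
other colour. -/
def IsForcedBy (V₀ X : Finset ℕ) (𝓢 : Set (ℕ × Finset ℕ)) (φ : ℕ → Fin 2) : Prop :=
  ∀ v ∈ X, v ∉ V₀ → ∃ S, (v, S) ∈ 𝓢 ∧ S ⊆ V₀ ∧ ∀ u ∈ S, φ u ≠ φ v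

/-- `𝓢` is a coloured star design on `X` that extends `𝓢₀` and is forced by `range (2 e m₀)`. -/
structure IsForcedExtension (e m₀ : ℕ) (𝓢₀ : Set (ℕ × Finset ℕ)) (X : Finset ℕ)
    (𝓢 : Set (ℕ × Finset ℕ)) : Prop where
  design : IsStarDesign e X 𝓢
  colouring : IsStarColouring 𝓢 (stripe e)
  subset : 𝓢₀ ⊆ 𝓢
  forced : IsForcedBy (range (2 * e * m₀)) X 𝓢 (stripe e)

theorem IsForcedExtension.exists_join {e m m₀ : ℕ} (he : 3 ≤ e) (hm₀ : 6 ≤ m₀) (hm : m₀ ≤ m)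
    {𝓢₀ 𝓢 𝓣 : Set (ℕ × Finset ℕ)} (h : IsForcedExtension e m₀ 𝓢₀ (range (2 * e * m)) 𝓢)
    {W : Finset ℕ} (hW : Disjoint (range (2 * e * m)) W) (h𝓣 : IsStarDesign e W 𝓣)
    (hφ : IsStarColouring 𝓣 (stripe e)) {D : Fin 2 → Finset ℕ}
    (hD : ∀ c, D c ⊆ range (2 * e * m₀)) (hDe : ∀ c, e ≤ #(D c))
    (hDe' : ∀ c, e ≤ #(range (2 * e * m₀) \ D c)) (h1 : ∀ c, ∃ x ∈ D c, stripe e x = c)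
    (h2 : ∀ c, ∃ x ∈ range (2 * e * m₀) \ D c, stripe e x = c) :
    ∃ 𝓢', IsForcedExtension e m₀ 𝓢₀ (range (2 * e * m) ∪ W) 𝓢' ∧ 𝓢 ⊆ 𝓢' ∧
      ∀ w ∈ W, ∀ c, c ≠ stripe e w → (∃ S, (w, S) ∈ 𝓢' ∧ S ⊆ D c) ∧
        ∃ S, (w, S) ∈ 𝓢' ∧ S ⊆ range (2 * e * m₀) \ D c := by
  choose 𝒬 h𝒬 h𝒬c h𝒬S h𝒬T h𝒬U using fun c =>
    exists_separating_partition he hm₀ hm (hD c) (hDe c) (hDe' c) (h1 c) (h2 c)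
  choose o ho using fun a : Fin 2 => exists_ne a
  refine ⟨𝓢 ∪ 𝓣 ∪ joinStars W fun w => 𝒬 (o (stripe e w)), ⟨?_, ?_, ?_, ?_⟩, ?_, ?_⟩
  · exact h.design.join h𝓣 hW fun w _ => h𝒬 _
  · refine isStarColouring_join h.colouring hφ fun w _ S hS => ?_
    obtain ⟨v, hv, hvc⟩ := h𝒬c _ S hS
    exact ⟨v, hv, hvc ▸ ho _⟩
  · exact fun s hs => Or.inl (Or.inl (h.subset hs))
  · intro v hv hv'
    rcases mem_union.1 hv with hv | hv
    · obtain ⟨S, hS, hS'⟩ := h.forced v hv hv'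
      exact ⟨S, Or.inl (Or.inl hS), hS'⟩
    · obtain ⟨S, hS, hS'⟩ := h𝒬U (o (stripe e v))
      refine ⟨S, Or.inr ⟨hv, hS⟩, hS'.trans (filter_subset _ _), fun u hu => ?_⟩
      rw [(mem_filter.1 (hS' hu)).2]
      exact ho _
  · exact fun s hs => Or.inl (Or.inl hs)
  · intro w hw c hc
    obtain rfl : c = o (stripe e w) := by
      have := ho (stripe e w)
      omega
    obtain ⟨S, hS, hS'⟩ := h𝒬S (o (stripe e w))
    obtain ⟨T, hT, hT'⟩ := h𝒬T (o (stripe e w))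
    exact ⟨⟨S, Or.inr ⟨hw, hS⟩, hS'⟩, ⟨T, Or.inr ⟨hw, hT⟩, hT'⟩⟩

/-- The first group serves as a harmless choice of `D` wherever no colouring has to be excluded. -/
theorem range_two_mul_separates {e m₀ : ℕ} (he : 1 ≤ e) (hm₀ : 2 ≤ m₀) :
    range (2 * e) ⊆ range (2 * e * m₀) ∧ e ≤ #(range (2 * e)) ∧
      e ≤ #(range (2 * e * m₀) \ range (2 * e)) ∧
      ∀ c, (∃ x ∈ range (2 * e), stripe e x = c) ∧
        ∃ x ∈ range (2 * e * m₀) \ range (2 * e), stripe e x = c := by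
  have h : 2 * e * 2 ≤ 2 * e * m₀ := Nat.mul_le_mul_left _ hm₀
  have hs : range (2 * e) ⊆ range (2 * e * m₀) := range_subset_range.2 (by omega)
  refine ⟨hs, by simp; omega, by rw [card_sdiff_of_subset hs]; simp; omega, fun c => ?_⟩
  rcases (by omega : c = 0 ∨ c = 1) with rfl | rfl
  · exact ⟨⟨0, by simp; omega, stripe_eq_zero (m := 0) (by simp) (by simp; omega)⟩,
      ⟨2 * e, by simp; omega, stripe_eq_zero (m := 1) (by simp) (by simp; omega)⟩⟩
  · exact ⟨⟨e, by simp; omega, stripe_eq_one (m := 0) (by simp) (by simp; omega)⟩,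
      ⟨2 * e + e, by simp; omega, stripe_eq_one (m := 1) (by simp) (by simp; omega)⟩⟩

theorem IsForcedExtension.exists_join' {e m m₀ : ℕ} (he : 3 ≤ e) (hm₀ : 6 ≤ m₀) (hm : m₀ ≤ m)
    {𝓢₀ 𝓢 𝓣 : Set (ℕ × Finset ℕ)} (h : IsForcedExtension e m₀ 𝓢₀ (range (2 * e * m)) 𝓢)
    {W : Finset ℕ} (hW : Disjoint (range (2 * e * m)) W) (h𝓣 : IsStarDesign e W 𝓣)
    (hφ : IsStarColouring 𝓣 (stripe e)) :
    ∃ 𝓢', IsForcedExtension e m₀ 𝓢₀ (range (2 * e * m) ∪ W) 𝓢' ∧ 𝓢 ⊆ 𝓢' := by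
  obtain ⟨a1, a2, a3, a4⟩ := range_two_mul_separates (e := e) (m₀ := m₀) (by omega) (by omega)
  obtain ⟨𝓢', h1, h2, -⟩ := h.exists_join he hm₀ hm hW h𝓣 hφ (D := fun _ => range (2 * e))
    (fun _ => a1) (fun _ => a2) (fun _ => a3) (fun c => (a4 c).1) (fun c => (a4 c).2)
  exact ⟨𝓢', h1, h2⟩

/-- A colouring of `V₀` that is large on both sides but does not factor through `stripe e` can be
excluded by adding one group of points. -/
theorem IsForcedExtension.exists_exclude {e m m₀ : ℕ} (he : 3 ≤ e) (hm₀ : 6 ≤ m₀) (hm : m₀ ≤ m)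
    {𝓢₀ 𝓢 : Set (ℕ × Finset ℕ)} (h : IsForcedExtension e m₀ 𝓢₀ (range (2 * e * m)) 𝓢)
    {ψ : ℕ → Fin 2} (hψ : ∀ c, e ≤ #{x ∈ range (2 * e * m₀) | ψ x = c}) {x y : ℕ}
    (hx : x ∈ range (2 * e * m₀)) (hy : y ∈ range (2 * e * m₀))
    (hxy : stripe e x = stripe e y) (hne : ψ x ≠ ψ y) :
    ∃ 𝓢', IsForcedExtension e m₀ 𝓢₀ (range (2 * e * (m + 1))) 𝓢' ∧ 𝓢 ⊆ 𝓢' ∧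
      ∀ χ, IsStarColouring 𝓢' χ →
        {x ∈ range (2 * e * m₀) | χ x = 0} ≠ {x ∈ range (2 * e * m₀) | ψ x = 0} := by
  obtain ⟨a1, a2, a3, a4⟩ := range_two_mul_separates (e := e) (m₀ := m₀) (by omega) (by omega)
  obtain ⟨𝓣, h𝓣, hφ⟩ := exists_group e m
  have hcompl : range (2 * e * m₀) \ {x ∈ range (2 * e * m₀) | ψ x = 0} =
      {x ∈ range (2 * e * m₀) | ψ x = 1} := by
    ext z
    simp only [mem_sdiff, mem_filter]
    have : ψ z = 0 ∨ ψ z = 1 := by omega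
    rcases this with h | h <;> simp [h]
  have key : ∀ a, ∃ z ∈ {x ∈ range (2 * e * m₀) | ψ x = a}, stripe e z = stripe e x := by
    intro a
    rcases (by omega : ψ x = a ∨ ψ y = a) with h | h
    · exact ⟨x, mem_filter.2 ⟨hx, h⟩, rfl⟩
    · exact ⟨y, mem_filter.2 ⟨hy, h⟩, hxy.symm⟩
  obtain ⟨𝓢', h1, h2, h3⟩ := h.exists_join he hm₀ hm (disjoint_range_Ico _ _) h𝓣 hφ
    (D := fun c => if c = stripe e x then {x ∈ range (2 * e * m₀) | ψ x = 0} else range (2 * e))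
    (fun c => by
      split_ifs
      · exact filter_subset _ _
      · exact a1)
    (fun c => by
      split_ifs
      · exact hψ 0
      · exact a2)
    (fun c => by
      split_ifs
      · rw [hcompl]; exact hψ 1
      · exact a3)
    (fun c => by
      split_ifs with hc
      · subst hc; exact key 0
      · exact (a4 c).1)
    (fun c => by
      split_ifs with hc
      · subst hc; rw [hcompl]; exact key 1
      · exact (a4 c).2)
  rw [← range_mul_succ] at h1
  refine ⟨𝓢', h1, h2, fun χ hχ heq => ?_⟩
  obtain ⟨w, hw, hwc⟩ : ∃ w ∈ Ico (2 * e * m) (2 * e * m + 2 * e), stripe e x ≠ stripe e w := by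
    rcases (by omega : stripe e x = 0 ∨ stripe e x = 1) with h | h
    · exact ⟨2 * e * m + e, by simp; omega, by
        rw [h, stripe_eq_one (m := m) (by omega) (by omega)]; decide⟩
    · exact ⟨2 * e * m, by simp; omega, by
        rw [h, stripe_eq_zero (m := m) (by omega) (by omega)]; decide⟩
  obtain ⟨⟨S, hS, hSD⟩, ⟨T, hT, hTD⟩⟩ := h3 w hw _ hwc
  rw [if_pos rfl, ← heq] at hSD hTD
  -- The leaves in `S` all have colour 0 and those in `T` colour 1, so no colour is left for `w`.
  obtain ⟨u, hu, hu'⟩ := hχ _ hS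
  obtain ⟨v, hv, hv'⟩ := hχ _ hT
  have e1 := (mem_filter.1 (hSD hu)).2
  have e2 := mem_sdiff.1 (hTD hv)
  have e3 : χ v ≠ 0 := fun h => e2.2 (mem_filter.2 ⟨e2.1, h⟩)
  dsimp only at hu' hv'
  omega

/-! ### Excluding all bad colourings, and rigidity. -/

/-- Induction on the set of forbidden colour classes: a class that still occurs for a bad colouring
costs one more group, and restricting colourings to the smaller design keeps earlier exclusions. -/
theorem exists_isForcedExtension_excluding {e m₀ : ℕ} (he : 3 ≤ e) (hm₀ : 6 ≤ m₀)
    {𝓢₀ : Set (ℕ × Finset ℕ)} (h𝓢₀ : IsForcedExtension e m₀ 𝓢₀ (range (2 * e * m₀)) 𝓢₀)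
    (hcard : ∀ ψ, IsStarColouring 𝓢₀ ψ → ∀ c, e ≤ #{x ∈ range (2 * e * m₀) | ψ x = c})
    (bad : Finset (Finset ℕ)) :
    ∃ m ≥ m₀, ∃ 𝓢, IsForcedExtension e m₀ 𝓢₀ (range (2 * e * m)) 𝓢 ∧
      ∀ ψ, IsStarColouring 𝓢 ψ → {x ∈ range (2 * e * m₀) | ψ x = 0} ∈ bad →
        ∀ x ∈ range (2 * e * m₀), ∀ y ∈ range (2 * e * m₀), stripe e x = stripe e y →
          ψ x = ψ y := by
  induction bad using Finset.induction_on with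
  | empty => exact ⟨m₀, le_rfl, 𝓢₀, h𝓢₀, by simp⟩
  | insert D bad _ ih =>
    obtain ⟨m, hm, 𝓢, h𝓢, hbad⟩ := ih
    by_cases hD : ∃ ψ, IsStarColouring 𝓢 ψ ∧ {x ∈ range (2 * e * m₀) | ψ x = 0} = D ∧
        ∃ x ∈ range (2 * e * m₀), ∃ y ∈ range (2 * e * m₀), stripe e x = stripe e y ∧ ψ x ≠ ψ y
    · obtain ⟨ψ, hψ, rfl, x, hx, y, hy, hxy, hne⟩ := hD
      obtain ⟨𝓢', h1, h2, h3⟩ := h𝓢.exists_exclude he hm₀ hm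
        (hcard ψ (hψ.mono h𝓢.subset)) hx hy hxy hne
      refine ⟨m + 1, by omega, 𝓢', h1, fun χ hχ hmem => ?_⟩
      rcases mem_insert.1 hmem with h | h
      · exact absurd h (h3 χ hχ)
      · exact hbad χ (hχ.mono h2) h
    · refine ⟨m, hm, 𝓢, h𝓢, fun χ hχ hmem => ?_⟩
      rcases mem_insert.1 hmem with h | h
      · intro x hx y hy hxy
        by_contra hne
        exact hD ⟨χ, hχ, h, x, hx, y, hy, hxy, hne⟩
      · exact hbad χ hχ h

/-- All colourings of `𝓢` agree with `φ` on `X` up to a permutation of the colours. -/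
def IsRigidOn (X : Finset ℕ) (𝓢 : Set (ℕ × Finset ℕ)) (φ : ℕ → Fin 2) : Prop :=
  ∀ ψ, IsStarColouring 𝓢 ψ → ∃ σ : Equiv.Perm (Fin 2), ∀ x ∈ X, ψ x = σ (φ x)

theorem IsRigidOn.of_isForcedBy {V₀ X : Finset ℕ} {𝓢 : Set (ℕ × Finset ℕ)} {φ : ℕ → Fin 2}
    (h : IsRigidOn V₀ 𝓢 φ) (hf : IsForcedBy V₀ X 𝓢 φ) : IsRigidOn X 𝓢 φ := by
  intro ψ hψ
  obtain ⟨σ, hσ⟩ := h ψ hψ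
  refine ⟨σ, fun x hx => ?_⟩
  by_cases hx₀ : x ∈ V₀
  · exact hσ x hx₀
  · obtain ⟨S, hS, hS₀, hne⟩ := hf x hx hx₀
    obtain ⟨u, hu, hu'⟩ := hψ _ hS
    have h1 := hσ u (hS₀ hu)
    have h2 : σ (φ u) ≠ σ (φ x) := fun h => hne u hu (σ.injective h)
    dsimp only at hu'
    omega

theorem exists_rigid_base {e : ℕ} (he : 3 ≤ e) :
    ∃ m₁ ≥ 2 * e, ∃ 𝓢₀ 𝓢₁, IsForcedExtension e (2 * e) 𝓢₀ (range (2 * e * m₁)) 𝓢₁ ∧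
      IsRigidOn (range (2 * e * (2 * e))) 𝓢₁ (stripe e) := by
  obtain ⟨𝓢₀, h1, h2, h3⟩ := exists_isStarDesign_card_le he (2 * e)
  obtain ⟨m₁, hm₁, 𝓢₁, h𝓢₁, hfac⟩ := exists_isForcedExtension_excluding he
    (m₀ := 2 * e) (by omega)
    ⟨h1, h2, subset_rfl, fun v hv hv' => absurd hv hv'⟩
    (fun ψ hψ c => le_trans (by omega) (h3 ψ hψ c)) (range (2 * e * (2 * e))).powerset
  refine ⟨m₁, hm₁, 𝓢₀, 𝓢₁, h𝓢₁, fun ψ hψ => ?_⟩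
  have hfac' := hfac ψ hψ (mem_powerset.2 (filter_subset _ _))
  have hrep : ∀ c, ∃ x ∈ range (2 * e * (2 * e)), stripe e x = c := fun c => by
    obtain ⟨a1, -, -, a4⟩ := range_two_mul_separates (e := e) (m₀ := 2 * e) (by omega) (by omega)
    obtain ⟨x, hx, hxc⟩ := (a4 c).1
    exact ⟨x, a1 hx, hxc⟩
  choose r hr hrc using hrep
  -- `ψ` is constant on stripe classes of the base but uses both colours there, so it induces a
  -- permutation of the colours.
  have hsurj : Function.Surjective fun c => ψ (r c) := by
    intro a
    obtain ⟨x, hx⟩ := card_pos.1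
      (lt_of_lt_of_le (by omega : 0 < 2 * e) (h3 ψ (hψ.mono h𝓢₁.subset) a))
    obtain ⟨hx, hxa⟩ := mem_filter.1 hx
    exact ⟨stripe e x, by rw [← hxa]; exact hfac' _ (hr _) _ hx (hrc _)⟩
  exact ⟨Equiv.ofBijective _ (Finite.surjective_iff_bijective.1 hsurj),
    fun x hx => hfac' _ hx _ (hr _) (hrc _).symm⟩

theorem exists_rigid {e : ℕ} (he : 3 ≤ e) :
    ∃ m₁, ∀ m ≥ m₁, ∀ n, n = 2 * e * m ∨ n = 2 * e * m + 1 →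
      ∃ 𝓢, IsStarDesign e (range n) 𝓢 ∧ IsStarColouring 𝓢 (stripe e) ∧
        IsRigidOn (range n) 𝓢 (stripe e) := by
  obtain ⟨m₁, hm₁, 𝓢₀, 𝓢₁, h𝓢₁, hrig⟩ := exists_rigid_base he
  have hall : ∀ m ≥ m₁, ∃ 𝓢, IsForcedExtension e (2 * e) 𝓢₀ (range (2 * e * m)) 𝓢 ∧ 𝓢₁ ⊆ 𝓢 := by
    intro m hm
    induction m, hm using Nat.le_induction with
    | base => exact ⟨𝓢₁, h𝓢₁, subset_rfl⟩
    | succ m hm ih =>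
      obtain ⟨𝓢, h𝓢, hsub⟩ := ih
      obtain ⟨𝓣, h𝓣, hφ⟩ := exists_group e m
      obtain ⟨𝓢', h1, h2⟩ := h𝓢.exists_join' he (by omega) (hm₁.trans hm)
        (disjoint_range_Ico _ _) h𝓣 hφ
      exact ⟨𝓢', range_mul_succ e m ▸ h1, hsub.trans h2⟩
  have hfin : ∀ X 𝓢, IsForcedExtension e (2 * e) 𝓢₀ X 𝓢 → 𝓢₁ ⊆ 𝓢 →
      IsStarDesign e X 𝓢 ∧ IsStarColouring 𝓢 (stripe e) ∧ IsRigidOn X 𝓢 (stripe e) :=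
    fun X 𝓢 h hsub => ⟨h.design, h.colouring,
      IsRigidOn.of_isForcedBy (fun ψ hψ => hrig ψ (hψ.mono hsub)) h.forced⟩
  refine ⟨m₁, fun m hm n hn => ?_⟩
  obtain ⟨𝓢, h𝓢, hsub⟩ := hall m hm
  rcases hn with rfl | rfl
  · exact ⟨𝓢, hfin _ _ h𝓢 hsub⟩
  · obtain ⟨𝓢', h1, h2⟩ := h𝓢.exists_join' he (by omega) (hm₁.trans hm)
      (W := {2 * e * m}) (by simp) (isStarDesign_singleton e _) (by simp [IsStarColouring])
    rw [union_comm, ← insert_eq, ← range_add_one] at h1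
    exact ⟨𝓢', hfin _ _ h1 (hsub.trans h2)⟩

/-! ### From star designs to star systems. -/

/-- The subgraph of the complete graph on `Fin n` given by a pair (centre, leaves). -/
def starSubgraph (n : ℕ) (s : ℕ × Finset ℕ) : (⊤ : SimpleGraph (Fin n)).Subgraph where
  verts := {v | (v : ℕ) = s.1 ∨ (v : ℕ) ∈ s.2}
  Adj u v := u ≠ v ∧ ((u : ℕ) = s.1 ∧ (v : ℕ) ∈ s.2 ∨ (v : ℕ) = s.1 ∧ (u : ℕ) ∈ s.2)
  adj_sub h := h.1
  edge_vert h := by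
    rcases h.2 with h | h
    · exact Or.inl h.1
    · exact Or.inr h.2
  symm := ⟨fun _ _ h => ⟨h.1.symm, h.2.symm⟩⟩

theorem nonempty_starSubgraph_iso {n e : ℕ} {s : ℕ × Finset ℕ} (h1 : s.1 ∈ range n)
    (h2 : s.2 ⊆ range n) (h3 : s.1 ∉ s.2) (h4 : #s.2 = e) :
    Nonempty ((starSubgraph n s).coe ≃g starGraphOfSize e) := by
  let f := (s.2.equivFinOfCardEq h4).symm
  let g : Fin 1 ⊕ Fin e → (starSubgraph n s).verts := Sum.elim
    (fun _ => ⟨⟨s.1, mem_range.1 h1⟩, Or.inl rfl⟩)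
    (fun i => ⟨⟨f i, mem_range.1 (h2 (f i).2)⟩, Or.inr (f i).2⟩)
  have hl : ∀ i, ((g (Sum.inl i) : Fin n) : ℕ) = s.1 := fun _ => rfl
  have hr : ∀ i, ((g (Sum.inr i) : Fin n) : ℕ) = f i := fun _ => rfl
  have hne : ∀ i, (f i : ℕ) ≠ s.1 := fun i h => h3 (h ▸ (f i).2)
  have hg : Function.Bijective g := by
    constructor
    · rintro (a | a) (b | b) hab
      · rw [Subsingleton.elim a b]
      · have := congrArg (fun v : (starSubgraph n s).verts => ((v : Fin n) : ℕ)) hab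
        exact absurd this.symm (hne b)
      · have := congrArg (fun v : (starSubgraph n s).verts => ((v : Fin n) : ℕ)) hab
        exact absurd this (hne a)
      · have := congrArg (fun v : (starSubgraph n s).verts => ((v : Fin n) : ℕ)) hab
        exact congrArg Sum.inr (f.injective (Subtype.ext this))
    · rintro ⟨v, hv | hv⟩
      · exact ⟨Sum.inl 0, Subtype.ext (Fin.ext hv.symm)⟩
      · refine ⟨Sum.inr (f.symm ⟨v, hv⟩), Subtype.ext (Fin.ext ?_)⟩
        rw [hr, Equiv.apply_symm_apply]
  refine ⟨SimpleGraph.Iso.symm ⟨Equiv.ofBijective g hg, ?_⟩⟩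
  intro a b
  rw [Equiv.ofBijective_apply, Equiv.ofBijective_apply, SimpleGraph.Subgraph.coe_adj]
  rcases a with a | a <;> rcases b with b | b <;>
    simp [starSubgraph, Fin.ext_iff, hl, hr, h3, hne, (hne _).symm]

/-- A rigid coloured star design on `range n` gives a uniquely `2`-chromatic star system. -/
theorem IsStarDesign.exists_isStarSystem {e n : ℕ} (hn : 2 ≤ n) {𝓢 : Set (ℕ × Finset ℕ)}
    {φ : ℕ → Fin 2} (h : IsStarDesign e (range n) 𝓢) (hφ : IsStarColouring 𝓢 φ)
    (hr : IsRigidOn (range n) 𝓢 φ) :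
    ∃ 𝓑 : Set (⊤ : SimpleGraph (Fin n)).Subgraph,
      IsStarSystem e 𝓑 ∧ IsUniquelyBlockChromatic 𝓑 2 := by
  have hcol : IsBlockColouring (starSubgraph n '' 𝓢) fun v => φ v := by
    rintro _ ⟨s, hs, rfl⟩ ⟨i, hi⟩
    obtain ⟨v, hv, hne⟩ := hφ s hs
    exact hne ((hi ⟨v, mem_range.1 (h.leaves_subset s hs hv)⟩ (Or.inr hv)).trans
      (hi ⟨s.1, mem_range.1 (h.centre_mem s hs)⟩ (Or.inl rfl)).symm)
  refine ⟨starSubgraph n '' 𝓢, ⟨?_, ?_⟩, ⟨⟨_, hcol⟩, ?_⟩, _, hcol, ?_⟩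
  · rintro _ ⟨s, hs, rfl⟩
    exact nonempty_starSubgraph_iso (h.centre_mem s hs) (h.leaves_subset s hs)
      (h.centre_notMem s hs) (h.card_leaves s hs)
  · intro x hx
    induction x using Sym2.ind with
    | _ a b =>
    have hab : a ≠ b := by simpa using hx
    obtain ⟨s, ⟨hs, h1⟩, hu⟩ := h.existsUnique a (mem_range.2 a.2) b (mem_range.2 b.2)
      (fun h => hab (Fin.ext h))
    refine ⟨starSubgraph n s, ⟨⟨s, hs, rfl⟩, ?_⟩, ?_⟩
    · rw [SimpleGraph.Subgraph.mem_edgeSet]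
      exact ⟨hab, h1.imp (And.imp_left Eq.symm) (And.imp_left Eq.symm)⟩
    · rintro _ ⟨⟨t, ht, rfl⟩, h2⟩
      rw [SimpleGraph.Subgraph.mem_edgeSet] at h2
      rw [hu t ⟨ht, h2.2.imp (And.imp_left Eq.symm) (And.imp_left Eq.symm)⟩]
  · rintro ⟨χ, hχ⟩
    obtain ⟨s, hs⟩ := h.exists_star (x := 0) (y := 1) (by simp; omega) (by simp; omega)
      (by omega)
    exact hχ _ ⟨s, hs, rfl⟩ ⟨0, fun v _ => Subsingleton.elim (α := Fin 1) _ _⟩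
  · intro ψ hψ
    -- The value 0 outside `range n` is irrelevant, since all stars lie in `range n`.
    obtain ⟨σ, hσ⟩ := hr (fun x => if hx : x < n then ψ ⟨x, hx⟩ else 0) (by
      intro s hs
      by_contra! hall
      refine hψ _ ⟨s, hs, rfl⟩ ⟨if hx : s.1 < n then ψ ⟨s.1, hx⟩ else 0, fun v hv => ?_⟩
      rcases hv with hv | hv
      · simp [← hv]
      · simpa using hall v hv)
    exact ⟨σ, funext fun v => by simpa using hσ v (mem_range.2 v.2)⟩

theorem mainTheorem4 (e : ℕ) (he : 3 ≤ e) :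
    ∃ n₀ : ℕ, n₀ ≡ 0 [MOD 2 * e] ∧
      ∀ n : ℕ, n₀ ≤ n → (n ≡ 0 [MOD 2 * e] ∨ n ≡ 1 [MOD 2 * e]) →
        ∃ 𝓑 : Set (⊤ : SimpleGraph (Fin n)).Subgraph,
          IsStarSystem e 𝓑 ∧ IsUniquelyBlockChromatic 𝓑 2 := by
  obtain ⟨m₁, hm₁⟩ := exists_rigid he
  -- Taking `m₁ + 1` in place of `m₁` guarantees `2 ≤ n`, so that a block exists and one colour does
  -- not suffice.
  refine ⟨2 * e * (m₁ + 1), by simp [Nat.ModEq], fun n hn hmod => ?_⟩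
  have hn' : n = 2 * e * (n / (2 * e)) ∨ n = 2 * e * (n / (2 * e)) + 1 := by
    have hdiv := Nat.div_add_mod n (2 * e)
    rcases hmod with h | h
    · left
      rw [Nat.ModEq, Nat.zero_mod] at h
      omega
    · right
      rw [Nat.ModEq, Nat.mod_eq_of_lt (a := 1) (by omega)] at h
      omega
  have hm : m₁ + 1 ≤ n / (2 * e) := by
    rw [Nat.le_div_iff_mul_le (by omega), mul_comm]
    exact hn
  obtain ⟨𝓢, h1, h2, h3⟩ := hm₁ _ (by omega) n hn'
  exact h1.exists_isStarSystem (by rw [Nat.mul_succ] at hn; omega) h2 h3
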